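/- Let $\mathbb{K}$ be $\mathbb{C}$ or $\mathbb{R}$, let $n\ge 3$ be an integer and let $r_1,\dots,r_n\in\mathbb{K}$. Let $\mathfrak{g}(n)$ be the Lie algebra over $\mathbb{K}$ given by the generators $p_1,\dots,p_n$ and the relations $$[p_i,[p_i,p_k]]-[p_j,[p_j,p_k]]=(r_j-r_i)\,p_k\quad (i\ne k,\ j\ne k),\qquad [p_i,[p_j,p_k]]=0\quad (i\ne k,\ i\ne j,\ j\ne k),$$ where $i,j,k\in\{1,\dots,n\}$. Let $Q=\mathbb{K}[\lambda_1,\dots,\lambda_n]/I$, where $I$ is the ideal generated by the polynomials $\lambda_i^2-\lambda_j^2+r_i-r_j$ for $i,j=1,\dots,n$, and let $\bar\lambda_i$ be the image of $\lambda_i$ in $Q$. Let $\mathfrak{so}_{n,1}$ be the Lie algebra of the matrices $A\in\mathfrak{gl}_{n+1}(\mathbb{K})$ with $A^{T}J+JA=0$, where $J=\mathrm{diag}(1,\dots,1,-1)$, and let $E_{a,b}$ be the matrix whose $(a,b)$ entry is $1$ and whose other entries are $0$. In the Lie algebra $\mathfrak{so}_{n,1}\otimes_{\mathbb{K}}Q$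 over $\mathbb{K}$, with bracket $[g_1\otimes q_1,g_2\otimes q_2]=[g_1,g_2]\otimes q_1q_2$, put $$Q_i=(E_{i,n+1}+E_{n+1,i})\otimes\bar\lambda_i,\qquad i=1,\dots,n,$$ and let $L(n)$ be the Lie subalgebra over $\mathbb{K}$ generated by $Q_1,\dots,Q_n$. Then $L(n)$ is infinite-dimensional, and the assignment $p_i\mapsto Q_i$ ($i=1,\dots,n$) defines an isomorphism of Lie algebras $\varphi\colon\mathfrak{g}(n)\to L(n)$. -/

import Mathlib

open scoped TensorProduct

noncomputable section

namespace LandauLifshitz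

/-- The relators, in the free Lie algebra on `p_1, …, p_n`, of the Lie algebra `𝔤(n)`. -/
def relators (K : Type*) [Field K] {n : ℕ} (r : Fin n → K) : Set (FreeLieAlgebra K (Fin n)) :=
  let p : Fin n → FreeLieAlgebra K (Fin n) := FreeLieAlgebra.of K
  {x | ∃ i j k : Fin n, i ≠ k ∧ j ≠ k ∧
      x = ⁅p i, ⁅p i, p k⁆⁆ - ⁅p j, ⁅p j, p k⁆⁆ - (r j - r i) • p k} ∪
  {x | ∃ i j k : Fin n, i ≠ k ∧ i ≠ j ∧ j ≠ k ∧ x = ⁅p i, ⁅p j, p k⁆⁆}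

/-- The Lie algebra `𝔤(n)`: the free Lie algebra on `p_1, …, p_n` modulo the Lie ideal generated by
`[p_i, [p_i, p_k]] - [p_j, [p_j, p_k]] - (r_j - r_i) p_k` (`i ≠ k`, `j ≠ k`) and
`[p_i, [p_j, p_k]]` (`i, j, k` distinct). -/
abbrev g (K : Type*) [Field K] {n : ℕ} (r : Fin n → K) : Type _ :=
  FreeLieAlgebra K (Fin n) ⧸ LieSubmodule.lieSpan K (FreeLieAlgebra K (Fin n)) (relators K r)

/-- The image in `𝔤(n)` of the generator `p_i` of the free Lie algebra. -/
def p {K : Type*} [Field K] {n : ℕ} (r : Fin n → K) (i : Fin n) : g K r :=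
  LieSubmodule.Quotient.mk (FreeLieAlgebra.of K i)

/-- The ideal of `K[λ_1, …, λ_n]` generated by `λ_i ^ 2 - λ_j ^ 2 + r_i - r_j`, for all `i, j`. -/
def curveIdeal {K : Type*} [Field K] {n : ℕ} (r : Fin n → K) : Ideal (MvPolynomial (Fin n) K) :=
  Ideal.span {f | ∃ i j : Fin n, f = MvPolynomial.X i ^ 2 - MvPolynomial.X j ^ 2 +
    MvPolynomial.C (r i) - MvPolynomial.C (r j)}

/-- The algebra `Q = K[λ_1, …, λ_n] / I` of polynomial functions on the curve
`λ_i ^ 2 - λ_j ^ 2 = r_j - r_i`. -/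
abbrev CurveRing {K : Type*} [Field K] {n : ℕ} (r : Fin n → K) : Type _ :=
  MvPolynomial (Fin n) K ⧸ curveIdeal r

/-- The image of the coordinate `λ_i` in the algebra `Q`. -/
def lam {K : Type*} [Field K] {n : ℕ} (r : Fin n → K) (i : Fin n) : CurveRing r :=
  Ideal.Quotient.mk (curveIdeal r) (MvPolynomial.X i)

/-- The Lie algebra `𝔰𝔬_{n,1}` over `K`, of matrices that are skew-adjoint for the form
`diag(1, …, 1, -1)`. The rows and columns `1, …, n` are indexed by `Fin n`, the last one by
`Unit`. -/
abbrev so (K : Type*) [Field K] (n : ℕ) :=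
  LieAlgebra.Orthogonal.so' (Fin n) Unit K

/-- The matrix `E_{i,n+1} + E_{n+1,i}` as an element of `𝔰𝔬_{n,1}`. -/
def boost (K : Type*) [Field K] {n : ℕ} (i : Fin n) : so K n :=
  ⟨Matrix.single (Sum.inl i) (Sum.inr ()) 1 + Matrix.single (Sum.inr ()) (Sum.inl i) 1, by
    rw [so, LieAlgebra.Orthogonal.so', mem_skewAdjointMatricesLieSubalgebra,
      mem_skewAdjointMatricesSubmodule, Matrix.IsSkewAdjoint, Matrix.IsAdjointPair,
      LieAlgebra.Orthogonal.indefiniteDiagonal]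
    ext a b
    rcases a with a | a <;> rcases b with b | b <;>
      simp [Matrix.single_apply]
    split_ifs <;> simp⟩

/-- The element `Q_i = (E_{i,n+1} + E_{n+1,i}) ⊗ λ_i` of the Lie algebra `𝔰𝔬_{n,1} ⊗ Q`, whose
bracket is `[q₁ ⊗ g₁, q₂ ⊗ g₂] = q₁ q₂ ⊗ [g₁, g₂]`. The scalar factor is written on the left. -/
def Qel {K : Type*} [Field K] {n : ℕ} (r : Fin n → K) (i : Fin n) : CurveRing r ⊗[K] so K n :=
  lam r i ⊗ₜ[K] boost K i

/-- The Lie algebra `L(n)`: the Lie subalgebra over `K` of `𝔰𝔬_{n,1} ⊗ Q` generated by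
`Q_1, …, Q_n`. -/
def L {K : Type*} [Field K] {n : ℕ} (r : Fin n → K) : LieSubalgebra K (CurveRing r ⊗[K] so K n) :=
  LieSubalgebra.lieSpan K (CurveRing r ⊗[K] so K n) (Set.range (Qel r))

end LandauLifshitz

end

noncomputable section

namespace LandauLifshitz

open Polynomial

/-! ### Brackets forced by the relations, by induction on the degree. -/

section Tower

variable {K G ι : Type*} [Field K] [LieRing G] [LieAlgebra K G]

/-! On the curve, `z = λ_i ^ 2 + r_i` does not depend on `i`, and `(ad Q_i) ^ 2 + r_i` multiplies
`b_k ⊗ q` by `z` whenever `i ≠ k`. `tower` imitates this in any Lie algebra satisfying the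
relations: `P k m` plays the role of `b_k ⊗ λ_k z ^ m`.

The main work is `Relations.level`: in characteristic zero and with a third index always available,
the relations alone force the `P k m` to bracket as their models do. Consequently the `P k m` and
the `[P i 0, P j m]` with `i < j` span `𝔤(n)` (`range_param_eq_top`). Their images in `𝔰𝔬_{n,1} ⊗ Q`
are linearly independent (`lift_param_injective`): matrix entries separate the components, and a
nonzero polynomial in `z` times `λ_i λ_j` is nonzero on the curve.

A spanning family with independent images makes the map injective. Its range is `L(n)` because
generators go to generators, and the dimension is infinite because `m` is unbounded. -/

/-- The elements `p` of a Lie algebra satisfy the defining relations of `𝔤(n)`. -/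
structure Relations (r : ι → K) (p : ι → G) : Prop where
  sq : ∀ i j k, i ≠ k → j ≠ k → ⁅p i, ⁅p i, p k⁆⁆ - ⁅p j, ⁅p j, p k⁆⁆ = (r j - r i) • p k
  triple : ∀ i j k, i ≠ k → i ≠ j → j ≠ k → ⁅p i, ⁅p j, p k⁆⁆ = 0

/-- The elements obtained from `p k` by iterating `(ad p_i) ^ 2 + r_i`, where `i = o k`. -/
def tower (r : ι → K) (p : ι → G) (o : ι → ι) (k : ι) : ℕ → G
  | 0 => p k
  | m + 1 => ⁅p (o k), ⁅p (o k), tower r p o k m⁆⁆ + r (o k) • tower r p o k m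

/-- The brackets of total degree `m` between members of the families `P k` behave like those of the
elements `b_k ⊗ λ_k z ^ a` of `𝔰𝔬_{n,1} ⊗ Q`. -/
structure Level (r : ι → K) (P : ι → ℕ → G) (m : ℕ) : Prop where
  self : ∀ k a b, a + b = m → ⁅P k a, P k b⁆ = 0
  pair : ∀ j k, j ≠ k → ∀ a b, a + b = m → ⁅P j a, P k b⁆ = ⁅P j 0, P k m⁆
  triple : ∀ i j k, i ≠ k → i ≠ j → j ≠ k → ∀ a b c, a + b + c = m →
    ⁅P i a, ⁅P j b, P k c⁆⁆ = 0
  succ : ∀ i k, i ≠ k → ⁅P i 0, ⁅P i 0, P k m⁆⁆ = P k (m + 1) - r i • P k m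

variable {r : ι → K} {p : ι → G} {P : ι → ℕ → G} {m : ℕ}

theorem Relations.level_zero (h : Relations r p) {o : ι → ι} (ho : ∀ k, o k ≠ k) :
    Level r (tower r p o) 0 where
  self k a b hab := by
    obtain ⟨rfl, rfl⟩ : a = 0 ∧ b = 0 := by omega
    exact lie_self _
  pair j k _ a b hab := by
    obtain ⟨rfl, rfl⟩ : a = 0 ∧ b = 0 := by omega
    rfl
  triple i j k h1 h2 h3 a b c habc := by
    obtain ⟨rfl, rfl, rfl⟩ : a = 0 ∧ b = 0 ∧ c = 0 := by omega
    exact h.triple i j k h1 h2 h3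
  succ i k hik := by
    have := h.sq i (o k) k hik (ho k)
    simp only [tower]
    linear_combination (norm := module) this

/-- Lets `(ad x) ^ 2` pass from one factor of a bracket to the other; with `x = P i 0` for a third
index `i`, this moves one degree from `P j` to `P k`. -/
theorem lie_sq_lie_eq {x u v : G} (h₁ : ⁅x, ⁅u, v⁆⁆ = 0) (h₂ : ⁅u, ⁅x, v⁆⁆ = 0) :
    ⁅⁅x, ⁅x, u⁆⁆, v⁆ = ⁅u, ⁅x, ⁅x, v⁆⁆⁆ := by
  have h₃ : ⁅⁅x, u⁆, v⁆ = 0 := by rw [lie_lie, h₁, h₂, sub_zero]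
  rw [lie_lie x ⁅x, u⁆, h₃, lie_lie x u ⁅x, v⁆, h₂, lie_zero, zero_sub, zero_sub, neg_neg]

theorem Level.pair_comm (h : Level r P m) {j k : ι} (hjk : j ≠ k) {a b : ℕ} (hab : a + b = m) :
    ⁅P j a, P k b⁆ = -⁅P k 0, P j m⁆ := by
  rw [← lie_skew, h.pair k j hjk.symm b a (by omega)]

theorem Level.pair_succ (hι : ∀ i j : ι, ∃ k, k ≠ i ∧ k ≠ j) (h : ∀ l ≤ m, Level r P l)
    {j k : ι} (hjk : j ≠ k) {a b : ℕ} (hab : a + b = m + 1) :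
    ⁅P j a, P k b⁆ = ⁅P j 0, P k (m + 1)⁆ := by
  obtain ⟨i, hij, hik⟩ := hι j k
  have step : ∀ a b, a + b = m → ⁅P j (a + 1), P k b⁆ = ⁅P j a, P k (b + 1)⁆ := by
    intro a b hab
    have := lie_sq_lie_eq (x := P i 0) (u := P j a) (v := P k b)
      ((h m le_rfl).triple i j k hik hij hjk _ _ _ (by omega))
      ((h m le_rfl).triple j i k hjk hij.symm hik _ _ _ (by omega))
    rw [(h a (by omega)).succ i j hij, (h b (by omega)).succ i k hik, sub_lie, lie_sub, smul_lie,
      lie_smul] at this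
    -- The `r i` terms on the two sides are equal and cancel.
    simpa using this
  induction a generalizing b with
  | zero => rw [show b = m + 1 by omega]
  | succ a ih => rw [step a b (by omega), ih (by omega)]

theorem Level.triple_jacobi (h : ∀ l ≤ m, ∀ j k, j ≠ k → ∀ a b, a + b = l →
      ⁅P j a, P k b⁆ = ⁅P j 0, P k l⁆) {i j k : ι} (hik : i ≠ k) (hij : i ≠ j) (hjk : j ≠ k)
    {a b c : ℕ} (habc : a + b + c = m) :
    ⁅P i a, ⁅P j 0, P k (m - a)⁆⁆ + ⁅P j b, ⁅P k 0, P i (m - b)⁆⁆ +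
      ⁅P k c, ⁅P i 0, P j (m - c)⁆⁆ = 0 := by
  rw [← h (m - a) (by omega) j k hjk b c (by omega),
    ← h (m - b) (by omega) k i hik.symm c a (by omega),
    ← h (m - c) (by omega) i j hij a b (by omega)]
  exact lie_jacobi _ _ _

/-- The bracket of `[p_i, p_j]` with `P k (m + 1)`, computed in two ways. -/
theorem Level.triple_one (h : ∀ l ≤ m, Level r P l)
    (hF : ∀ j k, j ≠ k → ∀ a b, a + b = m + 1 → ⁅P j a, P k b⁆ = ⁅P j 0, P k (m + 1)⁆)
    {i j k : ι} (hik : i ≠ k) (hij : i ≠ j) (hjk : j ≠ k) :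
    ⁅P i 1, ⁅P j 0, P k m⁆⁆ =
      ⁅P i 0, ⁅P j 0, P k (m + 1)⁆⁆ + (2 : K) • ⁅P j 0, ⁅P k 0, P i (m + 1)⁆⁆ := by
  have e1 : ⁅P i 0, ⁅P j 0, P k m⁆⁆ = 0 :=
    (h m le_rfl).triple i j k hik hij hjk _ _ _ (by omega)
  have e2 : ⁅P j 0, ⁅P i 0, P k m⁆⁆ = 0 :=
    (h m le_rfl).triple j i k hjk hij.symm hik _ _ _ (by omega)
  have e3 : ⁅⁅P i 0, P j 0⁆, P k m⁆ = 0 := by rw [lie_lie, e1, e2, sub_zero]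
  -- Since `[P i 0, P j 0]` kills `P k m`, the Leibniz rule on `(ad P j 0) ^ 2 (P k m)` only
  -- differentiates the two outer factors `P j 0`.
  have e4 : ⁅⁅P i 0, P j 0⁆, P j 0⁆ = P i 1 - r j • P i 0 := by
    rw [← (h 0 (by omega)).succ j i hij.symm, ← lie_skew, ← lie_skew (P i 0), lie_neg, neg_neg]
  have e5 : ⁅P k 0, P i (m + 1)⁆ = -⁅P i 0, P k (m + 1)⁆ := by
    rw [← lie_skew, hF i k hik _ _ (by omega)]
  have e6 : ⁅P i 1, P k m⁆ = ⁅P i 0, P k (m + 1)⁆ := hF i k hik _ _ (by omega)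
  have e7 : ⁅⁅P i 0, P j 0⁆, P k (m + 1)⁆ =
      ⁅P i 1, ⁅P j 0, P k m⁆⁆ + ⁅P j 0, ⁅P i 0, P k (m + 1)⁆⁆ := by
    have hs := (h m le_rfl).succ j k hjk
    calc ⁅⁅P i 0, P j 0⁆, P k (m + 1)⁆
        = ⁅⁅P i 0, P j 0⁆, ⁅P j 0, ⁅P j 0, P k m⁆⁆ + r j • P k m⁆ := by rw [hs, sub_add_cancel]
      _ = ⁅P i 1 - r j • P i 0, ⁅P j 0, P k m⁆⁆ + ⁅P j 0, ⁅P i 1 - r j • P i 0, P k m⁆⁆ := by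
        rw [lie_add, lie_smul, e3, leibniz_lie, leibniz_lie ⁅P i 0, P j 0⁆ (P j 0) (P k m), e4, e3]
        simp
      _ = ⁅P i 1, ⁅P j 0, P k m⁆⁆ + ⁅P j 0, ⁅P i 0, P k (m + 1)⁆⁆ := by
        rw [sub_lie, sub_lie, smul_lie, smul_lie, e1, e6, lie_sub, lie_smul, e2]
        simp
  rw [lie_lie] at e7
  rw [e5, lie_neg]
  linear_combination (norm := module) -e7

/-- The last four relations give a common value `v` of `f 0`, `g 0`, `h 0`. Comparing the sums at
`(a + 1, 0, c)` and `(a, 1, c)` makes `f` arithmetic, `f a = (1 + 2a) v`; the sum at `(m, 0, 0)`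
then reads `(3 + 2m) v = 0`. -/
theorem eq_zero_of_add_add_eq_zero [CharZero K] {V : Type*} [AddCommGroup V] [Module K V]
    {f g h : ℕ → V} (hm : 0 < m) (hs : ∀ a b c, a + b + c = m → f a + g b + h c = 0)
    (hfg : f 1 = f 0 + (2 : K) • g 0) (hfh : f 1 = f 0 + (2 : K) • h 0)
    (hgf : g 1 = g 0 + (2 : K) • f 0) (hgh : g 1 = g 0 + (2 : K) • h 0) {a : ℕ} (ha : a ≤ m) :
    f a = 0 := by
  have two : (2 : K) ≠ 0 := two_ne_zero
  have e1 : g 0 = h 0 := smul_right_injective V two (add_left_cancel (hfg.symm.trans hfh))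
  have e2 : f 0 = h 0 := smul_right_injective V two (add_left_cancel (hgf.symm.trans hgh))
  have key : ∀ a ≤ m, f a = (1 + 2 * (a : K)) • h 0 := by
    intro a
    induction a with
    | zero => intro _; rw [e2]; simp
    | succ a ih =>
      intro ha
      have h1 := hs (a + 1) 0 (m - (a + 1)) (by omega)
      have h2 := hs a 1 (m - (a + 1)) (by omega)
      rw [ih (by omega), hgh] at h2
      push_cast
      linear_combination (norm := module) h1 - h2
  have h3 := hs m 0 0 (by omega)
  rw [key m le_rfl, e1] at h3
  have h4 : (3 + 2 * (m : K)) • h 0 = 0 := by linear_combination (norm := module) h3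
  have h5 : (3 + 2 * (m : K)) ≠ 0 := by exact_mod_cast (show 3 + 2 * m ≠ 0 by omega)
  rw [key a ha, (smul_eq_zero.mp h4).resolve_left h5, smul_zero]

/-- The Jacobi identity and four index permutations of `Level.triple_one` supply the linear system
of `eq_zero_of_add_add_eq_zero`. -/
theorem Level.triple_succ [CharZero K] (h : ∀ l ≤ m, Level r P l)
    (hF : ∀ j k, j ≠ k → ∀ a b, a + b = m + 1 → ⁅P j a, P k b⁆ = ⁅P j 0, P k (m + 1)⁆)
    {i j k : ι} (hik : i ≠ k) (hij : i ≠ j) (hjk : j ≠ k) {a b c : ℕ} (habc : a + b + c = m + 1) :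
    ⁅P i a, ⁅P j b, P k c⁆⁆ = 0 := by
  have hF' : ∀ l ≤ m + 1, ∀ j k, j ≠ k → ∀ a b, a + b = l → ⁅P j a, P k b⁆ = ⁅P j 0, P k l⁆ := by
    intro l hl
    rcases Nat.lt_or_ge m l with h1 | h1
    · obtain rfl : l = m + 1 := by omega
      exact hF
    · exact (h l h1).pair
  have flip : ∀ {j k : ι}, j ≠ k → ∀ l ≤ m + 1, ⁅P k 0, P j l⁆ = -⁅P j 0, P k l⁆ := by
    intro j k hjk l hl
    rw [← lie_skew, hF' l hl j k hjk _ _ (by omega)]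
  rw [hF' (b + c) (by omega) j k hjk b c rfl, show b + c = m + 1 - a by omega]
  have one {i j k : ι} (hik : i ≠ k) (hij : i ≠ j) (hjk : j ≠ k) :=
    Level.triple_one h hF hik hij hjk
  refine eq_zero_of_add_add_eq_zero (K := K) (m := m + 1)
    (f := fun a ↦ ⁅P i a, ⁅P j 0, P k (m + 1 - a)⁆⁆)
    (g := fun a ↦ ⁅P j a, ⁅P k 0, P i (m + 1 - a)⁆⁆)
    (h := fun a ↦ ⁅P k a, ⁅P i 0, P j (m + 1 - a)⁆⁆) (by omega)
    (fun a b c habc ↦ Level.triple_jacobi hF' hik hij hjk habc) ?_ ?_ ?_ ?_ (by omega)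
  · simpa using one hik hij hjk
  · have := one hij hik hjk.symm
    rw [flip hjk m (by omega), flip hjk (m + 1) le_rfl, flip hij (m + 1) le_rfl, lie_neg, lie_neg,
      lie_neg] at this
    simp only [Nat.sub_zero, Nat.add_sub_cancel]
    linear_combination (norm := module) -this
  · have := one hjk hij.symm hik
    rw [flip hik.symm m (by omega), flip hik.symm (m + 1) le_rfl, flip hjk (m + 1) le_rfl, lie_neg,
      lie_neg, lie_neg] at this
    simp only [Nat.sub_zero, Nat.add_sub_cancel]
    linear_combination (norm := module) -this
  · simpa using one hij.symm hjk hik.symm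

/-- The point of this form is that the first term on the right is antisymmetric in `a` and `b`,
while the second does not depend on them. -/
theorem Level.self_step (h : ∀ l ≤ m, Level r P l) {i k : ι} (hik : i ≠ k) {a b : ℕ}
    (hab : a + b = m) :
    ⁅P k a, P k (b + 1)⁆ = -⁅⁅P i 0, P k a⁆, ⁅P i 0, P k b⁆⁆ - ⁅P i 0, P i (m + 1)⁆ := by
  have hb := (h b (by omega)).succ i k hik
  have e1 : ⁅P i 0, P k b⁆ = -⁅P k 0, P i b⁆ := (h b (by omega)).pair_comm hik (by omega)
  have e2 : ⁅P k a, ⁅P k 0, P i b⁆⁆ = P i (m + 1) - r k • P i m := by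
    rw [leibniz_lie, (h a (by omega)).self k a 0 (by omega), zero_lie, zero_add,
      (h m le_rfl).pair k i hik.symm a b hab, (h m le_rfl).succ k i hik.symm]
  have e3 : ⁅P k a, ⁅P i 0, P k b⁆⁆ = -(P i (m + 1) - r k • P i m) := by rw [e1, lie_neg, e2]
  rw [show P k (b + 1) = ⁅P i 0, ⁅P i 0, P k b⁆⁆ + r i • P k b by rw [hb]; module, lie_add,
    lie_smul, (h m le_rfl).self k a b hab, leibniz_lie, e3, lie_neg, lie_sub, lie_smul,
    (h m le_rfl).self i 0 m (by omega), ← lie_skew (P k a) (P i 0), neg_lie]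
  module

/-- Put `t_k = [P k 0, P k (m + 1)]`. By `Level.self_step`, `[P k a, P k (m + 1 - a)]` grows by `2
t_i` with each step in `a`; skew-symmetry between `a = 0` and `a = m + 1` gives `t_k = -(m + 1)
t_i`. Using this for three distinct indices yields `(m + 1)(m + 2) t_k = 0`. -/
theorem Level.self_succ [CharZero K] (hι : ∀ i j : ι, ∃ k, k ≠ i ∧ k ≠ j)
    (h : ∀ l ≤ m, Level r P l) {k : ι} {a b : ℕ} (hab : a + b = m + 1) :
    ⁅P k a, P k b⁆ = 0 := by
  have two : (2 : K) ≠ 0 := two_ne_zero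
  have step : ∀ i k, i ≠ k → ∀ a ≤ m + 1,
      ⁅P k a, P k (m + 1 - a)⁆ = ⁅P k 0, P k (m + 1)⁆ + (2 * a : K) • ⁅P i 0, P i (m + 1)⁆ := by
    intro i k hik a
    induction a with
    | zero => intro _; simp
    | succ a ih =>
      intro ha
      obtain ⟨b, hb⟩ : ∃ b, a + b = m := ⟨m - a, by omega⟩
      have h1 := Level.self_step h hik hb
      have h2 := Level.self_step h hik ((add_comm b a).trans hb)
      have h3 := ih (by omega)
      rw [show m + 1 - a = b + 1 by omega] at h3
      rw [show m + 1 - (a + 1) = b by omega, ← lie_skew, h2, ← lie_skew ⁅P i 0, P k b⁆]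
      push_cast
      linear_combination (norm := module) h3 - h1
  have rel : ∀ i k, i ≠ k →
      ⁅P k 0, P k (m + 1)⁆ = (-(m + 1 : K)) • ⁅P i 0, P i (m + 1)⁆ := by
    intro i k hik
    have h1 := step i k hik (m + 1) le_rfl
    rw [Nat.sub_self, ← lie_skew] at h1
    push_cast at h1
    refine smul_right_injective G two ?_
    simp only
    linear_combination (norm := module) -h1
  have zero : ∀ k, ⁅P k 0, P k (m + 1)⁆ = 0 := by
    intro k
    obtain ⟨i, hik, -⟩ := hι k k
    obtain ⟨j, hji, hjk⟩ := hι i k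
    have h1 := rel i j hji.symm
    have h2 := rel k j hjk.symm
    have h3 := rel k i hik.symm
    rw [h2, h3] at h1
    have h4 : ((m + 1 : K) * (m + 2)) • ⁅P k 0, P k (m + 1)⁆ = 0 := by
      linear_combination (norm := module) -h1
    refine (smul_eq_zero.mp h4).resolve_left ?_
    exact_mod_cast (show (m + 1) * (m + 2) ≠ 0 by positivity)
  obtain ⟨i, hik, -⟩ := hι k k
  have := step i k hik a (by omega)
  rwa [zero, zero, smul_zero, add_zero, show m + 1 - a = b by omega] at this

/-- This makes the next tower step independent of the index used. Evaluate `[[P i 0, P k 0], P i (m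
+ 1)]` twice: directly, and through `P i (m + 1) = ((ad P j 0) ^ 2 + r j) (P i m)`, where `[P i 0, P
k 0]` commutes with `P j 0`. -/
theorem Level.sq_succ (h : ∀ l ≤ m, Level r P l)
    (hS : ∀ k, ⁅P k 0, P k (m + 1)⁆ = 0)
    (hF : ∀ j k, j ≠ k → ∀ a b, a + b = m + 1 → ⁅P j a, P k b⁆ = ⁅P j 0, P k (m + 1)⁆)
    {i j k : ι} (hik : i ≠ k) (hij : i ≠ j) (hjk : j ≠ k) :
    ⁅P i 0, ⁅P i 0, P k (m + 1)⁆⁆ =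
      ⁅P j 0, ⁅P j 0, P k (m + 1)⁆⁆ + r j • P k (m + 1) - r i • P k (m + 1) := by
  have e1 : ⁅P i 0, P k (m + 1)⁆ = -⁅P k 0, P i (m + 1)⁆ := by
    rw [← hF k i hik.symm (m + 1) 0 (by omega), lie_skew]
  have comm : ⁅⁅P i 0, P k 0⁆, P j 0⁆ = 0 := by
    rw [← lie_skew, (h 0 (by omega)).triple j i k hjk hij.symm hik _ _ _ rfl, neg_zero]
  have hm := (h m le_rfl)
  have e2 : ⁅⁅P i 0, P k 0⁆, P i m⁆ = -(P k (m + 1) - r i • P k m) := by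
    rw [lie_lie, hm.self i 0 m (by omega), lie_zero, sub_zero, hm.pair_comm hik.symm (by omega),
      lie_neg, hm.succ i k hik]
  have e3 : ⁅⁅P i 0, P k 0⁆, P i (m + 1)⁆ =
      -(⁅P j 0, ⁅P j 0, P k (m + 1)⁆⁆ + r j • P k (m + 1) - r i • P k (m + 1)) := by
    have hj := hm.succ j k hjk
    rw [show P i (m + 1) = ⁅P j 0, ⁅P j 0, P i m⁆⁆ + r j • P i m by
        rw [hm.succ j i hij.symm]; module,
      lie_add, lie_smul, leibniz_lie, comm, zero_lie, zero_add, leibniz_lie _ (P j 0) (P i m), comm,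
      zero_lie, zero_add, e2]
    simp only [lie_neg, lie_sub, lie_smul, hj]
    module
  rw [lie_lie, hS i, lie_zero, sub_zero] at e3
  rw [e1, lie_neg, e3, neg_neg]

theorem Relations.level [CharZero K] (hι : ∀ i j : ι, ∃ k, k ≠ i ∧ k ≠ j) (h : Relations r p)
    {o : ι → ι} (ho : ∀ k, o k ≠ k) (m : ℕ) : Level r (tower r p o) m := by
  induction m using Nat.strong_induction_on with
  | _ m ih =>
    rcases m with - | m
    · exact h.level_zero ho
    · replace ih : ∀ l ≤ m, Level r (tower r p o) l := fun l hl ↦ ih l (by omega)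
      have hF := fun j k (hjk : j ≠ k) a b (hab : a + b = m + 1) ↦ Level.pair_succ hι ih hjk hab
      have hS := fun k a b (hab : a + b = m + 1) ↦ Level.self_succ hι ih (k := k) hab
      refine ⟨hS, hF, fun i j k hik hij hjk a b c habc ↦ Level.triple_succ ih hF hik hij hjk habc,
        fun i k hik ↦ ?_⟩
      by_cases hio : i = o k
      · subst hio
        simp only [tower]
        module
      · rw [Level.sq_succ ih (fun k ↦ hS k _ _ (by omega)) hF hik hio (ho k)]
        simp only [tower]

end Tower

/-! ### A spanning family. -/

section Span

variable {K G ι : Type*} [Field K] [LieRing G] [LieAlgebra K G]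

/-- The elements whose adjoint action preserves `M` form a subalgebra containing the generators,
hence everything; so `M` is itself a subalgebra. -/
theorem submodule_eq_top_of_lie_mem {p : ι → G}
    (hp : LieSubalgebra.lieSpan K G (Set.range p) = ⊤) {M : Submodule K G} (hM : ∀ i, p i ∈ M)
    (hlie : ∀ i, ∀ x ∈ M, ⁅p i, x⁆ ∈ M) : M = ⊤ := by
  let S : LieSubalgebra K G :=
    { carrier := {x | ∀ y ∈ M, ⁅x, y⁆ ∈ M}
      add_mem' := fun {a b} ha hb y hy ↦ by rw [add_lie]; exact M.add_mem (ha y hy) (hb y hy)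
      zero_mem' := fun y _ ↦ by simp
      smul_mem' := fun c x hx y hy ↦ by rw [smul_lie]; exact M.smul_mem c (hx y hy)
      lie_mem' := fun {a b} ha hb y hy ↦ by
        rw [lie_lie]; exact M.sub_mem (ha _ (hb y hy)) (hb _ (ha y hy)) }
  have hS : ∀ x, x ∈ S := by
    have : LieSubalgebra.lieSpan K G (Set.range p) ≤ S := by
      rw [LieSubalgebra.lieSpan_le]
      rintro _ ⟨i, rfl⟩
      exact hlie i
    intro x
    exact this (hp ▸ LieSubalgebra.mem_top x)
  let T : LieSubalgebra K G := { M with lie_mem' := fun {a b} _ hb ↦ hS a b hb }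
  have : LieSubalgebra.lieSpan K G (Set.range p) ≤ T := by
    rw [LieSubalgebra.lieSpan_le]
    rintro _ ⟨i, rfl⟩
    exact hM i
  rw [eq_top_iff]
  intro x _
  exact this (hp ▸ LieSubalgebra.mem_top x)

/-- The linear map sending the family of monomials `X ^ m` to a given sequence. -/
def polyMap (v : ℕ → G) : K[X] →ₗ[K] G := (Polynomial.basisMonomials K).constr K v

@[simp]
theorem polyMap_monomial (v : ℕ → G) (m : ℕ) : polyMap (K := K) v (monomial m 1) = v m := by
  have := (Polynomial.basisMonomials K).constr_basis K v m
  rwa [coe_basisMonomials] at this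

variable [Fintype ι] [LinearOrder ι]

/-- The linear parametrization of the span of the elements `P k m` and `[P i 0, P j m]`, `i < j`. -/
def param (P : ι → ℕ → G) :
    (ι → K[X]) × ({e : ι × ι // e.1 < e.2} → K[X]) →ₗ[K] G :=
  (∑ k, polyMap (P k) ∘ₗ LinearMap.proj k) ∘ₗ LinearMap.fst K _ _ +
    (∑ e : {e : ι × ι // e.1 < e.2},
      polyMap (fun m ↦ ⁅P e.1.1 0, P e.1.2 m⁆) ∘ₗ LinearMap.proj e) ∘ₗ LinearMap.snd K _ _

theorem param_apply (P : ι → ℕ → G) (x : (ι → K[X]) × ({e : ι × ι // e.1 < e.2} → K[X])) :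
    param P x = ∑ k, polyMap (P k) (x.1 k) +
      ∑ e : {e : ι × ι // e.1 < e.2}, polyMap (fun m ↦ ⁅P e.1.1 0, P e.1.2 m⁆) (x.2 e) := by
  simp [param]

theorem mem_range_param_single (P : ι → ℕ → G) (k : ι) (m : ℕ) :
    P k m ∈ LinearMap.range (param (K := K) P) := by
  refine ⟨(Pi.single k (monomial m 1), 0), ?_⟩
  rw [param_apply, Finset.sum_eq_single k]
  · simp
  · intro j _ hj
    simp [hj]
  · simp

theorem mem_range_param_pair {P : ι → ℕ → G} (h : ∀ i j m, ⁅P i 0, P j m⁆ = -⁅P j 0, P i m⁆)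
    (hself : ∀ i m, ⁅P i 0, P i m⁆ = 0) (i j : ι) (m : ℕ) :
    ⁅P i 0, P j m⁆ ∈ LinearMap.range (param (K := K) P) := by
  have lt : ∀ {i j}, i < j → ⁅P i 0, P j m⁆ ∈ LinearMap.range (param (K := K) P) := by
    intro i j hij
    refine ⟨(0, Pi.single ⟨(i, j), hij⟩ (monomial m 1)), ?_⟩
    rw [param_apply, Finset.sum_eq_single (s := .univ (α := {e : ι × ι // e.1 < e.2}))
      ⟨(i, j), hij⟩]
    · simp
    · intro j _ hj
      simp [hj]
    · simp
  rcases lt_trichotomy i j with hij | rfl | hij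
  · exact lt hij
  · rw [hself]
    exact zero_mem _
  · rw [h]
    exact neg_mem (lt hij)

theorem range_param_eq_top {r : ι → K} {P : ι → ℕ → G}
    (h : ∀ m, Level r P m)
    (hgen : LieSubalgebra.lieSpan K G (Set.range fun i ↦ P i 0) = ⊤) :
    LinearMap.range (param (K := K) P) = ⊤ := by
  have hself : ∀ i m, ⁅P i 0, P i m⁆ = 0 := fun i m ↦ (h m).self i 0 m (by omega)
  have hskew : ∀ i j m, ⁅P i 0, P j m⁆ = -⁅P j 0, P i m⁆ := by
    intro i j m
    rcases eq_or_ne i j with rfl | hij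
    · rw [hself, neg_zero]
    · exact (h m).pair_comm hij (by omega)
  have single := mem_range_param_single (K := K) P
  have pair := mem_range_param_pair (K := K) hskew hself
  have sq : ∀ i k m, ⁅P i 0, ⁅P i 0, P k m⁆⁆ ∈ LinearMap.range (param (K := K) P) := by
    intro i k m
    rcases eq_or_ne i k with rfl | hik
    · rw [hself, lie_zero]
      exact zero_mem _
    · rw [(h m).succ i k hik]
      exact sub_mem (single _ _) (Submodule.smul_mem _ _ (single _ _))
  have triple : ∀ i j k m, ⁅P i 0, ⁅P j 0, P k m⁆⁆ ∈ LinearMap.range (param (K := K) P) := by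
    intro i j k m
    rcases eq_or_ne i j with rfl | hij
    · exact sq _ _ _
    rcases eq_or_ne i k with rfl | hik
    · rw [hskew j i, lie_neg]
      exact neg_mem (sq _ _ _)
    rcases eq_or_ne j k with rfl | hjk
    · rw [hself, lie_zero]
      exact zero_mem _
    · rw [(h m).triple i j k hik hij hjk 0 0 m (by omega)]
      exact zero_mem _
  have poly : ∀ (v : ℕ → G) (i : ι),
      (∀ m, ⁅P i 0, v m⁆ ∈ LinearMap.range (param (K := K) P)) → ∀ f : K[X],
      ⁅P i 0, polyMap v f⁆ ∈ LinearMap.range (param (K := K) P) := by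
    intro v i hv f
    induction f using Polynomial.induction_on' with
    | add f g hf hg =>
      rw [map_add, lie_add]
      exact add_mem hf hg
    | monomial m a =>
      rw [← mul_one a, ← smul_eq_mul, ← smul_monomial, map_smul, lie_smul, polyMap_monomial]
      exact Submodule.smul_mem _ _ (hv m)
  refine submodule_eq_top_of_lie_mem hgen (fun i ↦ single i 0) ?_
  rintro i _ ⟨x, rfl⟩
  rw [param_apply, lie_add, lie_sum, lie_sum]
  exact add_mem (sum_mem fun k _ ↦ poly _ _ (fun m ↦ pair i k m) _)
    (sum_mem fun e _ ↦ poly _ _ (fun m ↦ triple i _ _ m) _)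

end Span

/-! ### Functions on the curve. -/

section Curve

variable {K : Type*} [Field K] {n : ℕ} (r : Fin n → K)

theorem lam_sq_add (i j : Fin n) :
    lam r i ^ 2 + algebraMap K (CurveRing r) (r i) =
      lam r j ^ 2 + algebraMap K (CurveRing r) (r j) := by
  rw [← sub_eq_zero]
  have h : MvPolynomial.X i ^ 2 - MvPolynomial.X j ^ 2 + MvPolynomial.C (r i) -
      MvPolynomial.C (r j) ∈ curveIdeal r := Ideal.subset_span ⟨i, j, rfl⟩
  rw [← Ideal.Quotient.eq_zero_iff_mem] at h
  rw [← h]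
  have hC (a : K) : algebraMap K (CurveRing r) a = Ideal.Quotient.mk _ (MvPolynomial.C a) := rfl
  simp only [map_sub, map_add, map_pow, hC, lam]
  ring

/-- The algebra homomorphism given by a point of the curve. -/
def curvePoint {A : Type*} [CommRing A] [Algebra K A] (x : Fin n → A) (c : A)
    (hx : ∀ i, x i ^ 2 = c - algebraMap K A (r i)) : CurveRing r →ₐ[K] A :=
  Ideal.Quotient.liftₐ (curveIdeal r) (MvPolynomial.aeval x) <| by
    intro f hf
    refine (show curveIdeal r ≤ RingHom.ker (MvPolynomial.aeval (R := K) x) from ?_) hf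
    rw [curveIdeal, Ideal.span_le]
    rintro _ ⟨i, j, rfl⟩
    simp [hx, RingHom.mem_ker]

@[simp]
theorem curvePoint_lam {A : Type*} [CommRing A] [Algebra K A] (x : Fin n → A) (c : A)
    (hx : ∀ i, x i ^ 2 = c - algebraMap K A (r i)) (i : Fin n) :
    curvePoint r x c hx (lam r i) = x i :=
  (Ideal.Quotient.liftₐ_apply _ _ _ _).trans <| (Ideal.Quotient.lift_mk _ _ _).trans <| by simp

/-- The function `λ_i ^ 2 + r_i` on the curve is transcendental over `K`, and no coordinate divides
zero in the algebra it generates. -/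
theorem eq_zero_of_aeval_mul_lam_mul_lam [CharZero K] (o i j : Fin n) {f : K[X]}
    (hf : aeval (lam r o ^ 2 + algebraMap K (CurveRing r) (r o)) f * (lam r i * lam r j) = 0) :
    f = 0 := by
  classical
  let F := AlgebraicClosure K
  have : CharZero F := charZero_of_injective_algebraMap (algebraMap K F).injective
  by_contra h0
  have h1 : f.map (algebraMap K F) ≠ 0 :=
    (Polynomial.map_ne_zero_iff (algebraMap K F).injective).mpr h0
  -- A value `c` of `z` outside this set has `f c ≠ 0`, and any point above it has nonzero `i`-th
  -- and `j`-th coordinates. Such a point exists over the algebraic closure, by taking square roots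
  -- of `c - r k`.
  let bad : Finset F := (f.map (algebraMap K F)).roots.toFinset ∪
    {algebraMap K F (r i), algebraMap K F (r j)}
  obtain ⟨c, hc⟩ := Infinite.exists_notMem_finset bad
  choose x hx using fun k ↦ IsAlgClosed.exists_pow_nat_eq (c - algebraMap K F (r k)) two_pos
  have h2 := congrArg (curvePoint r x c hx) hf
  simp only [map_mul, map_zero, ← Polynomial.aeval_algHom_apply, map_add, map_pow, curvePoint_lam,
    AlgHom.commutes, hx, sub_add_cancel] at h2
  simp only [bad, Finset.mem_union, Multiset.mem_toFinset, Finset.mem_insert,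
    Finset.mem_singleton, mem_roots h1, IsRoot.def, eval_map_algebraMap, not_or] at hc
  have hne : ∀ k, c ≠ algebraMap K F (r k) → x k ≠ 0 := by
    intro k hk h3
    have := hx k
    rw [h3, zero_pow two_ne_zero] at this
    exact hk (sub_eq_zero.mp this.symm)
  rcases mul_eq_zero.mp h2 with h3 | h3
  · exact hc.1 h3
  · rcases mul_eq_zero.mp h3 with h4 | h4
    · exact hne i hc.2.1 h4
    · exact hne j hc.2.2 h4

end Curve

/-! ### Matrix computations in `𝔰𝔬_{n,1}`. -/

section Boost

variable {K : Type*} [Field K] {n : ℕ}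

theorem coe_lie_so (x y : so K n) : (⁅x, y⁆ : so K n).1 = x.1 * y.1 - y.1 * x.1 := rfl

theorem coe_boost (i : Fin n) : (boost K i).1 =
    Matrix.single (Sum.inl i) (Sum.inr ()) 1 + Matrix.single (Sum.inr ()) (Sum.inl i) 1 := rfl

theorem coe_lie_boost (i j : Fin n) :
    (⁅boost K i, boost K j⁆ : so K n).1 =
      Matrix.single (Sum.inl i) (Sum.inl j) 1 - Matrix.single (Sum.inl j) (Sum.inl i) 1 := by
  rw [coe_lie_so]
  rcases eq_or_ne i j with rfl | hij
  · simp
  · simp [coe_boost, mul_add, add_mul, Matrix.single_mul_single_of_ne, hij, hij.symm]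

theorem lie_boost_lie_boost_self {i k : Fin n} (hik : i ≠ k) :
    ⁅boost K i, ⁅boost K i, boost K k⁆⁆ = boost K k := by
  apply Subtype.ext
  rw [coe_lie_so, coe_lie_boost]
  simp [coe_boost, mul_sub, sub_mul, add_mul, mul_add, hik, hik.symm,
    Matrix.single_mul_single_of_ne, add_comm]

theorem lie_boost_lie_boost {i j k : Fin n} (hik : i ≠ k) (hij : i ≠ j) :
    ⁅boost K i, ⁅boost K j, boost K k⁆⁆ = 0 := by
  apply Subtype.ext
  rw [coe_lie_so, coe_lie_boost]
  simp [coe_boost, mul_sub, sub_mul, add_mul, mul_add, hik, hik.symm, hij, hij.symm,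
    Matrix.single_mul_single_of_ne]

/-- The `(a, b)` matrix entry of an element of `A ⊗ 𝔰𝔬_{n,1}`. -/
def entry (A : Type*) [CommRing A] [Algebra K A] (a b : Fin n ⊕ Unit) : A ⊗[K] so K n →ₗ[K] A :=
  TensorProduct.rid K A ∘ₗ LinearMap.lTensor A
    { toFun := fun x : so K n ↦ x.1 a b
      map_add' := fun _ _ ↦ rfl
      map_smul' := fun _ _ ↦ rfl }

theorem entry_tmul {A : Type*} [CommRing A] [Algebra K A] (a b : Fin n ⊕ Unit) (q : A)
    (x : so K n) : entry A a b (q ⊗ₜ[K] x) = x.1 a b • q := by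
  simp only [entry, LinearMap.comp_apply, LinearEquiv.coe_coe, LinearMap.lTensor_tmul,
    TensorProduct.rid_tmul]
  rfl

end Boost

/-! ### The presentation, its map to `L(n)`, and injectivity. -/

section Presentation

variable {K : Type*} [Field K] {n : ℕ} (r : Fin n → K)

/-- The projection of the free Lie algebra onto `𝔤(n)`. -/
def proj : FreeLieAlgebra K (Fin n) →ₗ⁅K⁆ g K r :=
  { (LieSubmodule.Quotient.mk' (LieSubmodule.lieSpan K (FreeLieAlgebra K (Fin n))
      (relators K r)) : FreeLieAlgebra K (Fin n) →ₗ[K] g K r) with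
    map_lie' := fun {x y} ↦ LieSubmodule.Quotient.mk_bracket _ x y }

theorem proj_surjective : Function.Surjective (proj r) :=
  LieSubmodule.Quotient.surjective_mk' _

theorem proj_of (i : Fin n) : proj r (FreeLieAlgebra.of K i) = p r i := rfl

theorem proj_eq_zero {x : FreeLieAlgebra K (Fin n)} (hx : x ∈ relators K r) : proj r x = 0 :=
  (LieSubmodule.Quotient.mk_eq_zero _).mpr (LieSubmodule.subset_lieSpan hx)

theorem lieSpan_range_p : LieSubalgebra.lieSpan K (g K r) (Set.range (p r)) = ⊤ := by
  let S := LieSubalgebra.lieSpan K (g K r) (Set.range (p r))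
  let F : FreeLieAlgebra K (Fin n) →ₗ⁅K⁆ S :=
    FreeLieAlgebra.lift K fun i ↦ ⟨p r i, LieSubalgebra.subset_lieSpan ⟨i, rfl⟩⟩
  have hF : S.incl.comp F = proj r := by
    refine FreeLieAlgebra.hom_ext fun i ↦ ?_
    simp [F, proj_of]
  rw [eq_top_iff]
  intro x _
  obtain ⟨y, rfl⟩ := proj_surjective r x
  rw [← hF]
  exact (F y).2

theorem relations_p : Relations r (p r) where
  sq i j k hik hjk := by
    have := proj_eq_zero r (Or.inl ⟨i, j, k, hik, hjk, rfl⟩)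
    simp only [map_sub, LieHom.map_lie, map_smul, proj_of] at this
    exact sub_eq_zero.mp this
  triple i j k hik hij hjk := by
    have := proj_eq_zero r (Or.inr ⟨i, j, k, hik, hij, hjk, rfl⟩)
    simpa only [LieHom.map_lie, proj_of] using this

/-- The homomorphism from `𝔤(n)` given by elements satisfying the defining relations. -/
def lift {G : Type*} [LieRing G] [LieAlgebra K G] {q : Fin n → G} (hq : Relations r q) :
    g K r →ₗ⁅K⁆ G :=
  have hle : LieSubmodule.lieSpan K (FreeLieAlgebra K (Fin n)) (relators K r) ≤
      (FreeLieAlgebra.lift K q).ker := by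
    rw [LieSubmodule.lieSpan_le]
    rintro x (⟨i, j, k, hik, hjk, rfl⟩ | ⟨i, j, k, hik, hij, hjk, rfl⟩)
    · simp [hq.sq i j k hik hjk]
    · simp [hq.triple i j k hik hij hjk]
  { Submodule.liftQ (LieSubmodule.lieSpan K (FreeLieAlgebra K (Fin n))
        (relators K r)).toSubmodule (FreeLieAlgebra.lift K q : FreeLieAlgebra K (Fin n) →ₗ[K] G)
      fun _ hx ↦ LieHom.mem_ker.mp (hle hx) with
    map_lie' := fun {x y} ↦ by
      obtain ⟨x, rfl⟩ := proj_surjective r x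
      obtain ⟨y, rfl⟩ := proj_surjective r y
      rw [← LieHom.map_lie]
      exact (FreeLieAlgebra.lift K q).map_lie x y }

theorem lift_p {G : Type*} [LieRing G] [LieAlgebra K G] {q : Fin n → G} (hq : Relations r q)
    (i : Fin n) : lift r hq (p r i) = q i :=
  FreeLieAlgebra.lift_of_apply q i

theorem relations_Qel : Relations r (Qel r) where
  sq i j k hik hjk := by
    simp only [Qel, LieAlgebra.ExtendScalars.bracket_tmul, lie_boost_lie_boost_self hik,
      lie_boost_lie_boost_self hjk]
    rw [← TensorProduct.sub_tmul, TensorProduct.smul_tmul']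
    congr 1
    rw [Algebra.smul_def, map_sub]
    linear_combination lam r k * lam_sq_add r i j
  triple i j k hik hij hjk := by
    simp [Qel, LieAlgebra.ExtendScalars.bracket_tmul, lie_boost_lie_boost hik hij]

/-- The index `s` is free because `λ_s ^ 2 + r_s` is the same function for every `s`; fixing it
gives all towers one common `z`. -/
theorem tower_Qel (o : Fin n → Fin n) (ho : ∀ k, o k ≠ k) (s k : Fin n) (m : ℕ) :
    tower r (Qel r) o k m =
      ((lam r s ^ 2 + algebraMap K (CurveRing r) (r s)) ^ m * lam r k) ⊗ₜ boost K k := by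
  induction m with
  | zero => simp [tower, Qel]
  | succ m ih =>
    rw [tower, ih]
    simp only [Qel, LieAlgebra.ExtendScalars.bracket_tmul, lie_boost_lie_boost_self (ho k)]
    rw [TensorProduct.smul_tmul', ← TensorProduct.add_tmul]
    congr 1
    rw [Algebra.smul_def, lam_sq_add r s (o k)]
    ring

theorem map_tower {G H ι : Type*} [LieRing G] [LieAlgebra K G] [LieRing H] [LieAlgebra K H]
    (f : G →ₗ⁅K⁆ H) (r : ι → K) (q : ι → G) (o : ι → ι) (k : ι) (m : ℕ) :
    f (tower r q o k m) = tower r (f ∘ q) o k m := by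
  induction m with
  | zero => rfl
  | succ m ih => simp [tower, ih]

theorem map_polyMap {G H : Type*} [LieRing G] [LieAlgebra K G] [LieRing H] [LieAlgebra K H]
    (f : G →ₗ⁅K⁆ H) (v : ℕ → G) (x : K[X]) :
    f (polyMap v x) = polyMap (fun m ↦ f (v m)) x := by
  have : (f : G →ₗ[K] H) ∘ₗ polyMap v = polyMap fun m ↦ f (v m) := by
    refine Polynomial.lhom_ext' fun m ↦ LinearMap.ext_ring ?_
    simp
  exact LinearMap.congr_fun this x

theorem polyMap_tmul {A V : Type*} [CommRing A] [Algebra K A] [LieRing V] [LieAlgebra K V]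
    (z q : A) (v : V) (x : K[X]) :
    polyMap (fun m ↦ (z ^ m * q) ⊗ₜ[K] v) x = (aeval z x * q) ⊗ₜ[K] v := by
  have : polyMap (fun m ↦ (z ^ m * q) ⊗ₜ[K] v) =
      (TensorProduct.mk K A V).flip v ∘ₗ LinearMap.mulRight K q ∘ₗ
        (aeval z : K[X] →ₐ[K] A).toLinearMap := by
    refine Polynomial.lhom_ext' fun m ↦ LinearMap.ext_ring ?_
    simp [aeval_monomial]
  rw [this]
  simp

theorem range_lift_Qel : (lift r (relations_Qel r)).range = L r := by
  rw [LieHom.range_eq_map, ← lieSpan_range_p, LieSubalgebra.map_lieSpan, ← Set.range_comp, L]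
  congr 2
  exact funext (lift_p r _)

theorem exists_ne_ne (hn : 3 ≤ n) (i j : Fin n) : ∃ k, k ≠ i ∧ k ≠ j := by
  obtain ⟨k, -, hk⟩ := Finset.exists_mem_notMem_of_card_lt_card (s := {i, j}) (t := .univ)
    (lt_of_le_of_lt Finset.card_le_two (by rw [Finset.card_univ, Fintype.card_fin]; omega))
  exact ⟨k, by simpa using hk⟩

variable [CharZero K]

/-- The images of the elements parametrizing `𝔤(n)` are linearly independent. -/
theorem lift_param_injective {o : Fin n → Fin n} (ho : ∀ k, o k ≠ k) :
    Function.Injective (lift r (relations_Qel r) ∘ param (K := K) (tower r (p r) o)) := by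
  have hlift : lift r (relations_Qel r) ∘ p r = Qel r := funext (lift_p r _)
  change Function.Injective
    ((lift r (relations_Qel r) : g K r →ₗ[K] CurveRing r ⊗[K] so K n) ∘ₗ
      param (K := K) (tower r (p r) o))
  rw [injective_iff_map_eq_zero]
  intro x hx
  rcases n with - | n
  · exact Subsingleton.elim _ _
  let z := lam r 0 ^ 2 + algebraMap K (CurveRing r) (r 0)
  have hx' : ∑ k, (aeval z (x.1 k) * lam r k) ⊗ₜ[K] boost K k +
      ∑ e : {e : Fin (n + 1) × Fin (n + 1) // e.1 < e.2},
        (aeval z (x.2 e) * (lam r e.1.1 * lam r e.1.2)) ⊗ₜ[K]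
          ⁅boost K e.1.1, boost K e.1.2⁆ = 0 := by
    rw [← hx]
    simp only [LinearMap.comp_apply, LieHom.coe_toLinearMap, param_apply, map_add, map_sum,
      map_polyMap, LieHom.map_lie, map_tower, hlift, tower_Qel r o ho 0,
      LieAlgebra.ExtendScalars.bracket_tmul]
    simp only [← polyMap_tmul]
    congr! 4
    ext m
    rw [pow_zero, one_mul, mul_left_comm]
  refine Prod.ext (funext fun k ↦ ?_) (funext fun e ↦ ?_)
  -- Brackets of boosts vanish in the last column, and only the `k`-th boost has a nonzero entry in
  -- row `k` there.
  · have h := congrArg (entry (CurveRing r) (Sum.inl k) (Sum.inr ())) hx'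
    simp only [map_add, map_sum, entry_tmul, coe_lie_boost, coe_boost, map_zero] at h
    rw [Finset.sum_eq_single k (by intro j _ hj; simp [hj]) (by simp),
      Finset.sum_eq_zero (by intro e _; simp)] at h
    refine eq_zero_of_aeval_mul_lam_mul_lam r 0 k k ?_
    have h' : aeval z (x.1 k) * lam r k = 0 := by simpa using h
    -- A spare factor `λ_k` is inserted to match the two-coordinate lemma.
    rw [← mul_assoc, h', zero_mul]
  · have h := congrArg (entry (CurveRing r) (Sum.inl e.1.1) (Sum.inl e.1.2)) hx'
    simp only [map_add, map_sum, entry_tmul, coe_lie_boost, coe_boost, map_zero] at h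
    rw [Finset.sum_eq_zero (s := .univ (α := Fin (n + 1)))
        (by intro j _; simp),
      Finset.sum_eq_single e ?_ (by simp)] at h
    · refine eq_zero_of_aeval_mul_lam_mul_lam r 0 e.1.1 e.1.2 ?_
      simpa [Matrix.single_apply, e.2.ne, e.2.ne'] using h
    · intro e' _ he
      have h1 : ¬(e'.1.1 = e.1.1 ∧ e'.1.2 = e.1.2) := fun h ↦ he (Subtype.ext (Prod.ext h.1 h.2))
      have h2 : ¬(e'.1.2 = e.1.1 ∧ e'.1.1 = e.1.2) := fun h ↦
        absurd e'.2 (by rw [h.1, h.2]; exact e.2.not_gt)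
      simp [h1, h2]

theorem lift_Qel_injective (hn : 3 ≤ n) : Function.Injective (lift r (relations_Qel r)) := by
  have hι := exists_ne_ne hn
  choose o ho using fun k ↦ hι k k
  have hsurj := LinearMap.range_eq_top.mp <| range_param_eq_top
    (fun m ↦ (relations_p r).level hι (fun k ↦ (ho k).1) m) (lieSpan_range_p r)
  exact (lift_param_injective r fun k ↦ (ho k).1).of_comp_right hsurj

theorem not_finite_g (hn : 3 ≤ n) : ¬ Module.Finite K (g K r) := by
  have hι := exists_ne_ne hn
  choose o ho using fun k ↦ hι k k
  intro hfin
  have hinj := (lift_param_injective r fun k ↦ (ho k).1).of_comp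
  have hfin' := Module.Finite.of_injective _ hinj
  let k : Fin n := ⟨0, by omega⟩
  exact Polynomial.not_finite (R := K) <| Module.Finite.of_surjective
    (LinearMap.proj k ∘ₗ LinearMap.fst K (Fin n → K[X])
      ({e : Fin n × Fin n // e.1 < e.2} → K[X]))
    ((Function.surjective_eval k).comp Prod.fst_surjective)

/-- The isomorphism `𝔤(n) ≃ L(n)` sending `p_i` to `Q_i`. -/
def equivL (hn : 3 ≤ n) : g K r ≃ₗ⁅K⁆ L r :=
  (LieEquiv.ofInjective _ (lift_Qel_injective r hn)).trans
    (LieEquiv.ofEq _ _ (congrArg _ (range_lift_Qel r)))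

theorem coe_equivL_p (hn : 3 ≤ n) (i : Fin n) :
    (equivL r hn (p r i) : CurveRing r ⊗[K] so K n) = Qel r i :=
  lift_p r (relations_Qel r) i

end Presentation

end LandauLifshitz

end

theorem theorem2 {𝕜 : Type*} [RCLike 𝕜] (n : ℕ) (hn : 3 ≤ n) (r : Fin n → 𝕜) :
    (∃ φ : LandauLifshitz.g 𝕜 r ≃ₗ⁅𝕜⁆ LandauLifshitz.L r,
      ∀ i : Fin n,
        (φ (LandauLifshitz.p r i) :
          LandauLifshitz.CurveRing r ⊗[𝕜] LandauLifshitz.so 𝕜 n) = LandauLifshitz.Qel r i) ∧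
    ¬ FiniteDimensional 𝕜 (LandauLifshitz.L r) := by
  refine ⟨⟨LandauLifshitz.equivL r hn, LandauLifshitz.coe_equivL_p r hn⟩, fun h ↦ ?_⟩
  exact LandauLifshitz.not_finite_g r hn
    (Module.Finite.equiv (LandauLifshitz.equivL r hn).symm.toLinearEquiv)
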